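/- Let $d\ge 2$ be an integer and $\epsilon\in(0,\tfrac12]$. Let $\mathbf{S}(\mathbb{C}^d)$ be the set of positive semidefinite operators of trace one on $\mathbb{C}^d$ (quantum states) and $\mathbf{P}(\mathbb{C}^d)=\{\phi\in\mathbf{S}(\mathbb{C}^d):\operatorname{tr}\phi^2=1\}$ the set of pure states. For a linear operator $M$ put $\|M\|_{\mathrm{tr}}:=\frac12\operatorname{tr}\sqrt{MM^\dagger}$. A deterministic encoding with finite label set $X$ is a family of (not necessarily pure) quantum states $\{\rho_x\in\mathbf{S}(\mathbb{C}^d)\}_{x\in X}$ that is an external $\epsilon$-covering of the pure states, i.e. $$\max_{\phi\in\mathbf{P}(\mathbb{C}^d)}\ \min_{x\in X}\ \|\phi-\rho_x\|_{\mathrm{tr}}<\epsilon .$$ Then a deterministic encoding exists, and the minimum $|X|$ of the sizes of the label sets of deterministic encodings satisfies $$2r(d,2\epsilon)\ \le\ \log_2|X|\ \le\ 2r(d,\epsilon)+\log_2(5d\ln d),\qquad r(d,\epsilon):=(d-1)\log_2\frac1\epsilon .$$ Moreover, if $d\ge 4$, the lower bound can be strengthened to $2r(d,\epsilon)\le\log_2|X|$.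 -/

import Mathlib

open scoped MatrixOrder ComplexOrder

noncomputable section

namespace StateEncoding

/-- The density operators (quantum states) on `ℂ^d`: positive semidefinite, of trace one. -/
def densityOps (d : ℕ) : Set (Matrix (Fin d) (Fin d) ℂ) :=
  {ρ | ρ.PosSemidef ∧ ρ.trace = 1}

/-- The pure states on `ℂ^d`: the density operators `ρ` with `tr (ρ ^ 2) = 1`. -/
def pureStates (d : ℕ) : Set (Matrix (Fin d) (Fin d) ℂ) :=
  {ρ | ρ ∈ densityOps d ∧ (ρ * ρ).trace = 1}

/-- Half the Schatten `1`-norm, `(1 / 2) tr √(M M†)`; the trace distance of two states `ρ`, `σ` is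
`halfTraceNorm (ρ - σ)`. The square root is that of the positive semidefinite matrix `M M†`, so
the trace is a nonnegative real number. -/
def halfTraceNorm {d : ℕ} (M : Matrix (Fin d) (Fin d) ℂ) : ℝ :=
  (CFC.sqrt (M * M.conjTranspose)).trace.re / 2

/-- A family of quantum states `ρ x`, `x ∈ X`, on `ℂ^d` is an external `ε`-covering of the pure
states (the set of states of a deterministic encoding of precision `ε`) if
`max_φ min_x ‖φ - ρ x‖ < ε`, where `φ` runs over all pure states.

The supremum and infimum are taken in `[0, ∞]`, where they always exist; an infimum over an empty
label set is `∞`. -/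
def IsExternalCovering (d : ℕ) (ε : ℝ) {X : Type*} (ρ : X → Matrix (Fin d) (Fin d) ℂ) : Prop :=
  (∀ x, ρ x ∈ densityOps d) ∧
    (⨆ φ : pureStates d, ⨅ x : X, ENNReal.ofReal (halfTraceNorm (φ.1 - ρ x))) < ENNReal.ofReal ε

/-- The sizes of the finite label sets of deterministic encodings of precision `ε`. -/
def encodingSizes (d : ℕ) (ε : ℝ) : Set ℕ :=
  {n | ∃ ρ : Fin n → Matrix (Fin d) (Fin d) ℂ, IsExternalCovering d ε ρ}

/-- `r(d, ε) = (d - 1) log₂ (1 / ε)`. -/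
def rate (d : ℕ) (ε : ℝ) : ℝ := ((d : ℝ) - 1) * Real.logb 2 (1 / ε)

end StateEncoding

end

/-! Both bounds compare measures of sets of pure states under the unitarily invariant measure,
realised by the standard Gaussian on `ℂ^d`; write `n = d - 1`. The sets that matter are quadratic
cones `∑ b_j |v_j|² < c |v_i|²` in a suitable orthonormal basis. The `|v_j|²` are independent
exponential variables, so such a cone has measure `∏ c / (c + b_j)` (`gaussian_quadratic`). In
particular a ball of radius `r ≤ 1` about a pure state has measure `r ^ (2n)`
(`gaussian_rayDist_lt`).

Lower bounds: the pure states within `ε` of a possibly mixed `ρ` lie in the cone `⟨v, (ρ + ε)⁻¹ v⟩ <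
‖v‖²` (`sum_div_lt_one_of_halfTraceNorm_lt`). If `K` bounds the measure of all these cones, a union
bound gives `1 ≤ N K`. Bounding each factor of the product gives `K = (2ε) ^ (2n)`; for `n ≥ 3`
bounding their mean gives `K = ε ^ (2n)`, the measure of a ball about a pure state.

Upper bound: `M` greedy balls of radius `r` slightly below `ε` leave measure at most `(1 - r ^ (2n))
^ M` uncovered. A maximal `2δ`-separated set of points at distance at least `r + δ` from the centres
has disjoint `δ`-balls inside the uncovered part, so it is small; adjoining it gives a covering of
radius `r + δ < ε` (`exists_covering`). Tuning `r`, `δ`, `M` yields the factor `5 d ln d`. -/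

noncomputable section

namespace StateEncoding

/-! ### Gaussian measure of quadratic cones -/

section Gaussian

open MeasureTheory Real

/-- The density of the standard complex Gaussian measure. -/
def gaussDensity (z : ℂ) : ℝ := π⁻¹ * exp (-‖z‖ ^ 2)

/-- The standard complex Gaussian measure, with density `exp (-‖z‖ ^ 2) / π`. -/
def complexGaussian : Measure ℂ := volume.withDensity fun z ↦ ENNReal.ofReal (gaussDensity z)

lemma gaussDensity_nonneg (z : ℂ) : 0 ≤ gaussDensity z := by unfold gaussDensity; positivity

lemma continuous_gaussDensity : Continuous gaussDensity := by unfold gaussDensity; fun_prop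

lemma integral_complexGaussian (f : ℂ → ℂ) :
    ∫ z, f z ∂complexGaussian = ∫ z, (gaussDensity z : ℂ) * f z := by
  rw [complexGaussian, integral_withDensity_eq_integral_toReal_smul (by
    exact continuous_gaussDensity.measurable.ennreal_ofReal) (by simp)]
  congr 1 with z
  rw [ENNReal.toReal_ofReal (gaussDensity_nonneg z), Complex.real_smul]

lemma integrable_exp_neg_mul_norm_sq {b : ℝ} (hb : 0 < b) :
    Integrable fun z : ℂ ↦ exp (-b * ‖z‖ ^ 2) := by
  refine Integrable.of_integral_ne_zero ?_
  rw [GaussianFourier.integral_rexp_neg_mul_sq_norm hb]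
  positivity

/-- In polar coordinates the radial integrand `2 y exp (-y²)` is an exact derivative: `‖z‖ ^ 2` is
an exponential variable of mean one. -/
lemma complexGaussian_tail {s : ℝ} (hs : 0 ≤ s) :
    complexGaussian {z | s < ‖z‖ ^ 2} = ENNReal.ofReal (exp (-s)) := by
  have hm : MeasurableSet {z : ℂ | s < ‖z‖ ^ 2} := measurableSet_lt (by fun_prop) (by fun_prop)
  have hint : Integrable gaussDensity := by
    have := (integrable_exp_neg_mul_norm_sq one_pos).const_mul π⁻¹
    simp only [neg_one_mul] at this
    exact this
  rw [complexGaussian, withDensity_apply _ hm, ← ofReal_integral_eq_lintegral_ofReal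
    hint.integrableOn (by filter_upwards with z using gaussDensity_nonneg z)]
  congr 1
  rw [← integral_indicator hm]
  set f : ℝ → ℝ := {r | s < r ^ 2}.indicator fun r ↦ π⁻¹ * exp (-r ^ 2) with hf
  have h1 : ∫ z : ℂ, {z : ℂ | s < ‖z‖ ^ 2}.indicator gaussDensity z = ∫ z : ℂ, f ‖z‖ := by
    congr 1
  rw [h1, integral_fun_norm_addHaar]
  have h2 : ∫ y in Set.Ioi (0 : ℝ), y ^ (Module.finrank ℝ ℂ - 1) • f y
      = ∫ y in Set.Ioi (√s), (2 * π)⁻¹ * (2 * y * exp (-y ^ 2)) := by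
    rw [← integral_indicator measurableSet_Ioi, ← integral_indicator measurableSet_Ioi]
    congr 1 with y
    have : y ∈ Set.Ioi (√s) ↔ y ∈ Set.Ioi (0 : ℝ) ∧ s < y ^ 2 := by
      simp only [Set.mem_Ioi]
      constructor
      · intro h
        have h0 : 0 < y := (sqrt_nonneg s).trans_lt h
        exact ⟨h0, (sqrt_lt' h0).1 h⟩
      · rintro ⟨h0, h⟩
        exact (sqrt_lt' h0).2 h
    by_cases h : y ∈ Set.Ioi (√s)
    · have h' := this.1 h
      rw [Set.indicator_of_mem h, Set.indicator_of_mem h'.1, hf, Set.indicator_of_mem (by exact h'.2)]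
      simp [Complex.finrank_real_complex]
      field_simp
    · rw [Set.indicator_of_notMem h]
      by_cases h0 : y ∈ Set.Ioi (0 : ℝ)
      · have : ¬ s < y ^ 2 := fun h' ↦ h (this.2 ⟨h0, h'⟩)
        rw [Set.indicator_of_mem h0, hf, Set.indicator_of_notMem (by exact this)]
        simp
      · rw [Set.indicator_of_notMem h0]
  have h3 : ∫ y in Set.Ioi (√s), 2 * y * exp (-y ^ 2) = exp (-s) := by
    have hlim : Filter.Tendsto (fun y : ℝ ↦ -exp (-y ^ 2)) Filter.atTop (nhds (-0)) := by
      refine Filter.Tendsto.neg (tendsto_exp_atBot.comp ?_)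
      exact Filter.tendsto_neg_atTop_atBot.comp (Filter.tendsto_pow_atTop two_ne_zero)
    rw [integral_Ioi_of_hasDerivAt_of_nonneg' (g := fun y ↦ -exp (-y ^ 2)) (l := -0) ?_ ?_ hlim]
    · simp [sq_sqrt hs]
    · intro y _
      have := ((hasDerivAt_pow 2 y).neg.exp).neg
      exact this.congr_deriv (by simp; ring)
    · intro y hy
      have : 0 < y := (sqrt_nonneg s).trans_lt hy
      positivity
  rw [h2, integral_const_mul, h3]
  have hvol : (volume : Measure ℂ).real (Metric.ball 0 1) = π := by
    simp [Measure.real, Complex.volume_ball]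
  rw [hvol, Complex.finrank_real_complex]
  simp
  field_simp

instance : IsProbabilityMeasure complexGaussian := by
  constructor
  have h := complexGaussian_tail le_rfl
  have h0 : complexGaussian {z | ¬ 0 < ‖z‖ ^ 2} = 0 := by
    have : {z : ℂ | ¬ 0 < ‖z‖ ^ 2} = {0} := by ext z; simp [sq_pos_iff]
    rw [this]
    exact withDensity_absolutelyContinuous _ _ (measure_singleton 0)
  have := measure_add_measure_compl (μ := complexGaussian) (s := {z : ℂ | 0 < ‖z‖ ^ 2})
    (measurableSet_lt (by fun_prop) (by fun_prop))
  rw [← this, h, Set.compl_ofPred, h0]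
  simp

lemma charFun_complexGaussian (t : ℂ) :
    charFun complexGaussian t = Complex.exp (-(‖t‖ : ℂ) ^ 2 / 4) := by
  rw [charFun, integral_complexGaussian]
  have := GaussianFourier.integral_cexp_neg_mul_sq_norm_add (V := ℂ) (b := 1) (by simp) Complex.I t
  have h : ∀ z : ℂ, (gaussDensity z : ℂ) * Complex.exp (inner ℝ z t * Complex.I)
      = (π : ℂ)⁻¹ * Complex.exp (-1 * ‖z‖ ^ 2 + Complex.I * (inner ℝ t z : ℝ)) := by
    intro z
    rw [Complex.exp_add, real_inner_comm, gaussDensity]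
    push_cast
    rw [mul_comm Complex.I]
    simp [mul_assoc]
  simp_rw [h]
  rw [integral_const_mul, this, Complex.finrank_real_complex]
  have hpi : (π : ℂ) ≠ 0 := by exact_mod_cast pi_ne_zero
  simp [hpi]

lemma integral_exp_complexGaussian {b : ℝ} (hb : 0 ≤ b) :
    ∫ z, exp (-b * ‖z‖ ^ 2) ∂complexGaussian = (1 + b)⁻¹ := by
  rw [complexGaussian, integral_withDensity_eq_integral_toReal_smul (by
    exact continuous_gaussDensity.measurable.ennreal_ofReal) (by simp)]
  have h : ∀ z : ℂ, (ENNReal.ofReal (gaussDensity z)).toReal • exp (-b * ‖z‖ ^ 2)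
      = π⁻¹ * exp (-(1 + b) * ‖z‖ ^ 2) := by
    intro z
    rw [ENNReal.toReal_ofReal (gaussDensity_nonneg z), gaussDensity, smul_eq_mul, mul_assoc,
      ← exp_add]
    ring_nf
  simp_rw [h]
  rw [integral_const_mul, GaussianFourier.integral_rexp_neg_mul_sq_norm (by positivity),
    Complex.finrank_real_complex]
  have : (1 + b) ≠ 0 := by positivity
  simp
  field_simp

/-- The standard Gaussian measure on `ℂ^d`. -/
def gaussian (d : ℕ) : Measure (EuclideanSpace ℂ (Fin d)) :=
  (Measure.pi fun _ ↦ complexGaussian).map (WithLp.toLp 2)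

instance (d : ℕ) : IsProbabilityMeasure (gaussian d) :=
  Measure.isProbabilityMeasure_map (by fun_prop)

lemma charFun_gaussian {d : ℕ} (t : EuclideanSpace ℂ (Fin d)) :
    charFun (gaussian d) t = Complex.exp (-(‖t‖ : ℂ) ^ 2 / 4) := by
  rw [gaussian, charFun_pi, ← Complex.ofReal_pow, EuclideanSpace.norm_sq_eq]
  simp_rw [charFun_complexGaussian]
  rw [← Complex.exp_sum]
  push_cast
  rw [← Finset.sum_div, Finset.sum_neg_distrib]

/-- The characteristic function depends on `‖t‖` alone, and a unitary acts on `t` through its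
inverse. -/
lemma gaussian_map {d : ℕ} (L : EuclideanSpace ℂ (Fin d) ≃ₗᵢ[ℂ] EuclideanSpace ℂ (Fin d)) :
    (gaussian d).map L = gaussian d := by
  have hL : Measurable L := L.continuous.measurable
  have := Measure.isProbabilityMeasure_map (μ := gaussian d) hL.aemeasurable
  apply Measure.ext_of_charFun
  ext t
  have hinner : ∀ x y : EuclideanSpace ℂ (Fin d), inner ℝ x y = (inner ℂ x y).re := by
    intro x y
    simp [PiLp.inner_apply]
  rw [charFun, integral_map hL.aemeasurable (by fun_prop)]
  have h : ∀ x, inner ℝ (L x) t = inner ℝ x (L.symm t) := by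
    intro x
    rw [hinner, hinner, ← L.inner_map_map x, L.apply_symm_apply]
  simp_rw [h]
  rw [← charFun, charFun_gaussian, charFun_gaussian, L.symm.norm_map]

/-- For fixed other coordinates this is a tail event of the exponential variable `‖v i‖ ^ 2`. Its
probability is a product of exponentials, whose integral factors into Laplace transforms `(1 + b j /
c)⁻¹`. -/
lemma pi_complexGaussian_quadratic {n : ℕ} (i : Fin (n + 1)) (b : Fin n → ℝ) (hb : ∀ j, 0 ≤ b j)
    {c : ℝ} (hc : 0 < c) :
    (Measure.pi fun _ : Fin (n + 1) ↦ complexGaussian)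
      {v | ∑ j, b j * ‖v (i.succAbove j)‖ ^ 2 < c * ‖v i‖ ^ 2}
      = ENNReal.ofReal (∏ j, c / (c + b j)) := by
  have mp := measurePreserving_piFinSuccAbove (fun _ : Fin (n + 1) ↦ complexGaussian) i
  set A : Set (ℂ × (Fin n → ℂ)) := {p | ∑ j, b j * ‖p.2 j‖ ^ 2 < c * ‖p.1‖ ^ 2} with hA
  have hAm : MeasurableSet A := measurableSet_lt (by fun_prop) (by fun_prop)
  have hpre : {v : Fin (n + 1) → ℂ | ∑ j, b j * ‖v (i.succAbove j)‖ ^ 2 < c * ‖v i‖ ^ 2}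
      = (MeasurableEquiv.piFinSuccAbove (fun _ ↦ ℂ) i) ⁻¹' A := by
    ext v
    simp [hA, MeasurableEquiv.piFinSuccAbove_apply, Fin.removeNth]
  rw [hpre, mp.measure_preimage hAm.nullMeasurableSet, Measure.prod_apply_symm hAm]
  have h1 : ∀ w : Fin n → ℂ, complexGaussian ((fun z ↦ (z, w)) ⁻¹' A)
      = ENNReal.ofReal (∏ j, exp (-(b j / c) * ‖w j‖ ^ 2)) := by
    intro w
    have : (fun z ↦ (z, w)) ⁻¹' A = {z | ∑ j, b j / c * ‖w j‖ ^ 2 < ‖z‖ ^ 2} := by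
      ext z
      have : ∑ j, b j / c * ‖w j‖ ^ 2 = (∑ j, b j * ‖w j‖ ^ 2) / c := by
        rw [Finset.sum_div]; congr 1 with j; ring
      simp only [hA, Set.mem_preimage, Set.mem_ofPred_eq]
      rw [this, div_lt_iff₀' hc]
    rw [this, complexGaussian_tail (Finset.sum_nonneg fun j _ ↦ by have := hb j; positivity),
      ← exp_sum, ← Finset.sum_neg_distrib]
    simp_rw [neg_mul]
  simp_rw [h1]
  have hint : Integrable (fun w : Fin n → ℂ ↦ ∏ j, exp (-(b j / c) * ‖w j‖ ^ 2))
      (Measure.pi fun _ ↦ complexGaussian) := by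
    refine Integrable.fintype_prod (f := fun j (z : ℂ) ↦ exp (-(b j / c) * ‖z‖ ^ 2)) fun j ↦ ?_
    refine Integrable.of_integral_ne_zero ?_
    have := hb j
    rw [integral_exp_complexGaussian (by positivity)]
    positivity
  rw [← ofReal_integral_eq_lintegral_ofReal hint (by
    filter_upwards with w using Finset.prod_nonneg fun _ _ ↦ (exp_pos _).le)]
  congr 1
  rw [integral_fintype_prod_eq_prod (fun j (z : ℂ) ↦ exp (-(b j / c) * ‖z‖ ^ 2))]
  refine Finset.prod_congr rfl fun j _ ↦ ?_
  have := hb j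
  rw [integral_exp_complexGaussian (by positivity)]
  field_simp

/-- The Gaussian measure of a quadratic cone, in the coordinates of an orthonormal basis. -/
lemma gaussian_quadratic {n : ℕ}
    (B : OrthonormalBasis (Fin (n + 1)) ℂ (EuclideanSpace ℂ (Fin (n + 1))))
    (i : Fin (n + 1)) (b : Fin n → ℝ) (hb : ∀ j, 0 ≤ b j) {c : ℝ} (hc : 0 < c) :
    gaussian (n + 1) {v | ∑ j, b j * ‖B.repr v (i.succAbove j)‖ ^ 2 < c * ‖B.repr v i‖ ^ 2}
      = ENNReal.ofReal (∏ j, c / (c + b j)) := by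
  set S : Set (EuclideanSpace ℂ (Fin (n + 1))) :=
    {v | ∑ j, b j * ‖v (i.succAbove j)‖ ^ 2 < c * ‖v i‖ ^ 2} with hS
  have hSm : MeasurableSet S := measurableSet_lt (by fun_prop) (by fun_prop)
  have h1 : {v | ∑ j, b j * ‖B.repr v (i.succAbove j)‖ ^ 2 < c * ‖B.repr v i‖ ^ 2}
    = B.repr ⁻¹' S := rfl
  rw [h1, ← Measure.map_apply B.repr.continuous.measurable hSm, gaussian_map, gaussian,
    Measure.map_apply (by fun_prop) hSm]
  exact pi_complexGaussian_quadratic i b hb hc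

end Gaussian

/-! ### Trace distance and pure states -/

section TraceNorm

open Matrix

/-- The rank one operator `v v†`. -/
def rankOne {d : ℕ} (v : EuclideanSpace ℂ (Fin d)) : Matrix (Fin d) (Fin d) ℂ :=
  vecMulVec v.ofLp (star v.ofLp)

section Distance

variable {E : Type*} [NormedAddCommGroup E] [InnerProductSpace ℂ E]

/-- The trace distance `√(1 - |⟨v, w⟩|² / (‖v‖² ‖w‖²))` of the pure states spanned by two vectors. -/
def rayDist (v w : E) : ℝ := √(1 - ‖inner ℂ v w‖ ^ 2 / (‖v‖ ^ 2 * ‖w‖ ^ 2))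

lemma rayDist_comm (v w : E) : rayDist v w = rayDist w v := by
  rw [rayDist, rayDist, norm_inner_symm, mul_comm (‖v‖ ^ 2)]

lemma rayDist_smul_left {c : ℂ} (hc : c ≠ 0) (v w : E) : rayDist (c • v) w = rayDist v w := by
  have : ‖c‖ ≠ 0 := by simpa using hc
  rw [rayDist, rayDist, inner_smul_left, norm_mul, norm_smul, mul_pow, mul_pow, RCLike.norm_conj,
    mul_assoc, mul_div_mul_left _ _ (by positivity)]

lemma rayDist_smul_right {c : ℂ} (hc : c ≠ 0) (v w : E) : rayDist v (c • w) = rayDist v w := by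
  rw [rayDist_comm, rayDist_smul_left hc, rayDist_comm]

lemma rayDist_self {v : E} (hv : v ≠ 0) : rayDist v v = 0 := by
  have : ‖v‖ ≠ 0 := by simpa using hv
  rw [rayDist, inner_self_eq_norm_sq_to_K]
  simp
  field_simp
  simp

lemma norm_sub_smul_sq {u : E} (hu : ‖u‖ = 1) (w : E) (c : ℂ) :
    ‖w - c • u‖ ^ 2 = ‖w‖ ^ 2 - ‖inner ℂ u w‖ ^ 2 + ‖c - inner ℂ u w‖ ^ 2 := by
  rw [@norm_sub_sq ℂ, inner_smul_right, norm_smul, hu, mul_one, @norm_sub_sq ℂ ℂ]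
  have hre : (inner ℂ w u).re = (inner ℂ u w).re := by rw [← inner_conj_symm, Complex.conj_re]
  have him : (inner ℂ w u).im = -(inner ℂ u w).im := by rw [← inner_conj_symm, Complex.conj_im]
  simp [hre, him]
  ring

/-- The distance of two rays is the distance from `w` to the line `ℂ u`; this reduces the triangle
inequality to that of the norm. -/
lemma rayDist_eq_norm {u w : E} (hu : ‖u‖ = 1) (hw : ‖w‖ = 1) :
    rayDist u w = ‖w - inner ℂ u w • u‖ := by
  rw [rayDist, Real.sqrt_eq_iff_eq_sq _ (norm_nonneg _), norm_sub_smul_sq hu, hu, hw]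
  · simp
  · have := norm_inner_le_norm (𝕜 := ℂ) u w
    rw [hu, hw, one_mul] at this
    have := norm_nonneg (inner ℂ u w)
    rw [hu, hw]
    norm_num
    nlinarith

lemma rayDist_le_norm {u w : E} (hu : ‖u‖ = 1) (hw : ‖w‖ = 1) (c : ℂ) :
    rayDist u w ≤ ‖w - c • u‖ := by
  rw [rayDist, hu, hw]
  apply Real.sqrt_le_iff.2
  refine ⟨norm_nonneg _, ?_⟩
  rw [norm_sub_smul_sq hu, hw]
  nlinarith [sq_nonneg ‖c - inner ℂ u w‖]

/-- Project `w` to the line of `v` and the result to the line of `u`. The second error is scaled by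
`‖⟨v, w⟩‖ ≤ 1`. -/
lemma rayDist_triangle_of_norm_eq_one {u v w : E} (hu : ‖u‖ = 1) (hv : ‖v‖ = 1) (hw : ‖w‖ = 1) :
    rayDist u w ≤ rayDist u v + rayDist v w := by
  calc rayDist u w ≤ ‖w - (inner ℂ v w * inner ℂ u v) • u‖ := rayDist_le_norm hu hw _
    _ = ‖inner ℂ v w • (v - inner ℂ u v • u) + (w - inner ℂ v w • v)‖ := by
        congr 1; rw [smul_sub, smul_smul]; abel
    _ ≤ ‖inner ℂ v w • (v - inner ℂ u v • u)‖ + ‖w - inner ℂ v w • v‖ := norm_add_le _ _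
    _ ≤ rayDist u v + rayDist v w := by
        rw [norm_smul, ← rayDist_eq_norm hu hv, ← rayDist_eq_norm hv hw]
        have h : ‖inner ℂ v w‖ ≤ 1 := by simpa [hv, hw] using norm_inner_le_norm (𝕜 := ℂ) v w
        have h0 : 0 ≤ rayDist u v := Real.sqrt_nonneg _
        nlinarith

lemma rayDist_triangle {u v w : E} (hu : u ≠ 0) (hv : v ≠ 0) (hw : w ≠ 0) :
    rayDist u w ≤ rayDist u v + rayDist v w := by
  have key : ∀ x : E, x ≠ 0 → (‖x‖⁻¹ : ℂ) ≠ 0 ∧ ‖(‖x‖⁻¹ : ℂ) • x‖ = 1 := by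
    intro x hx
    have : ‖x‖ ≠ 0 := by simpa using hx
    refine ⟨by simpa using hx, ?_⟩
    rw [norm_smul]; simp [this]
  have := rayDist_triangle_of_norm_eq_one (key u hu).2 (key v hv).2 (key w hw).2
  simpa only [rayDist_smul_left (key u hu).1, rayDist_smul_left (key v hv).1,
    rayDist_smul_right (key w hw).1, rayDist_smul_right (key v hv).1] using this

end Distance

variable {d : ℕ}

lemma rankOne_isHermitian (v : EuclideanSpace ℂ (Fin d)) : (rankOne v).IsHermitian := by
  rw [rankOne, IsHermitian, conjTranspose_vecMulVec, star_star]

lemma star_dotProduct_eq_inner (v w : EuclideanSpace ℂ (Fin d)) :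
    star v.ofLp ⬝ᵥ w.ofLp = inner ℂ v w := by
  rw [EuclideanSpace.inner_eq_star_dotProduct, dotProduct_comm]

lemma rankOne_mul_rankOne (v w : EuclideanSpace ℂ (Fin d)) :
    rankOne v * rankOne w = inner ℂ v w • vecMulVec v.ofLp (star w.ofLp) := by
  rw [rankOne, rankOne, vecMulVec_mul_vecMulVec, star_dotProduct_eq_inner, vecMulVec_smul]

lemma trace_rankOne (v : EuclideanSpace ℂ (Fin d)) : (rankOne v).trace = (‖v‖ : ℂ) ^ 2 := by
  rw [rankOne, trace_vecMulVec, dotProduct_comm, star_dotProduct_eq_inner,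
    inner_self_eq_norm_sq_to_K]
  rfl

lemma rankOne_mul_self {v : EuclideanSpace ℂ (Fin d)} (hv : ‖v‖ = 1) :
    rankOne v * rankOne v = rankOne v := by
  rw [rankOne_mul_rankOne, inner_self_eq_norm_sq_to_K, hv, rankOne]
  simp

lemma rankOne_mem_pureStates {v : EuclideanSpace ℂ (Fin d)} (hv : ‖v‖ = 1) :
    rankOne v ∈ pureStates d := by
  refine ⟨⟨posSemidef_vecMulVec_self_star _, by simp [trace_rankOne, hv]⟩, ?_⟩
  simp [rankOne_mul_self hv, trace_rankOne, hv]

lemma trace_rankOne_mul_rankOne (v w : EuclideanSpace ℂ (Fin d)) :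
    (rankOne v * rankOne w).trace = (‖inner ℂ v w‖ : ℂ) ^ 2 := by
  rw [rankOne_mul_rankOne, trace_smul, trace_vecMulVec, dotProduct_comm, star_dotProduct_eq_inner,
    smul_eq_mul, ← inner_conj_symm w v, Complex.mul_conj']

lemma rankOne_mul_rankOne_mul_rankOne (v w : EuclideanSpace ℂ (Fin d)) :
    rankOne v * rankOne w * rankOne v = (‖inner ℂ v w‖ : ℂ) ^ 2 • rankOne v := by
  rw [rankOne_mul_rankOne, rankOne, smul_mul, vecMulVec_mul_vecMulVec, star_dotProduct_eq_inner,
    vecMulVec_smul, smul_smul, ← inner_conj_symm w v, Complex.mul_conj']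

/-- With `F = |⟨v, w⟩|²`, the difference satisfies `M³ = (1 - F) M`, so `M² / √(1 - F)` is the
positive square root of `M²`, and `tr M² = 2 (1 - F)`. If `F = 1`, this trace vanishes and `M = 0`.
-/
lemma halfTraceNorm_rankOne_sub {v w : EuclideanSpace ℂ (Fin d)} (hv : ‖v‖ = 1) (hw : ‖w‖ = 1) :
    halfTraceNorm (rankOne v - rankOne w) = rayDist v w := by
  set M := rankOne v - rankOne w with hM
  set F : ℝ := ‖inner ℂ v w‖ ^ 2 with hF
  have hMH : Mᴴ = M := ((rankOne_isHermitian v).sub (rankOne_isHermitian w)).eq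
  have hF1 : F ≤ 1 := by
    have := norm_inner_le_norm (𝕜 := ℂ) v w
    rw [hv, hw, one_mul] at this
    exact pow_le_one₀ (norm_nonneg _) this
  have hD : rayDist v w = √(1 - F) := by rw [rayDist, hv, hw]; simp [hF]
  have hvv := rankOne_mul_self hv
  have hww := rankOne_mul_self hw
  have hvwv : rankOne v * rankOne w * rankOne v = (F : ℂ) • rankOne v := by
    rw [rankOne_mul_rankOne_mul_rankOne, hF]; simp
  have hwvw : rankOne w * rankOne v * rankOne w = (F : ℂ) • rankOne w := by
    rw [rankOne_mul_rankOne_mul_rankOne, hF, norm_inner_symm]; simp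
  have htr : (M * M).trace = 2 * (1 - F) := by
    simp only [hM, sub_mul, mul_sub, trace_sub, hvv, hww, trace_rankOne_mul_rankOne, trace_rankOne,
      hv, hw, norm_inner_symm w v, hF]
    push_cast
    ring
  have hcube : M * M * M = ((1 - F : ℝ) : ℂ) • M := by
    have h1 : rankOne v * rankOne w * rankOne w = rankOne v * rankOne w := by rw [mul_assoc, hww]
    have h2 : rankOne w * rankOne v * rankOne v = rankOne w * rankOne v := by rw [mul_assoc, hvv]
    simp only [hM, sub_mul, mul_sub, hvv, hww, hvwv, hwvw, h1, h2, Complex.ofReal_sub, sub_smul,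
      smul_sub, Complex.ofReal_one, one_smul]
    abel
  rw [halfTraceNorm, hMH, hD]
  rcases hF1.eq_or_lt with h1 | h1
  · have : M = 0 := by
      rw [← trace_conjTranspose_mul_self_eq_zero_iff, hMH, htr, h1]; simp
    simp [this, h1]
  · have hpos : 0 < √(1 - F) := Real.sqrt_pos.2 (by linarith)
    have hsq : √(1 - F) * √(1 - F) = 1 - F := Real.mul_self_sqrt (by linarith)
    have hsqrt : CFC.sqrt (M * M) = (((√(1 - F))⁻¹ : ℝ) : ℂ) • (M * M) := by
      apply CFC.sqrt_unique
      · rw [smul_mul_smul_comm, ← mul_assoc, hcube, smul_mul_assoc, smul_smul,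
          ← Complex.ofReal_mul, ← Complex.ofReal_mul, ← mul_inv, hsq, inv_mul_cancel₀ (by linarith)]
        simp
      · rw [nonneg_iff_posSemidef]
        have : (M * M).PosSemidef := by
          have := posSemidef_conjTranspose_mul_self M
          rwa [hMH] at this
        exact this.smul (by
          rw [Complex.zero_le_real]; positivity)
    rw [hsqrt, trace_smul, htr, smul_eq_mul]
    have : ((((√(1 - F))⁻¹ : ℝ) : ℂ) * (2 * (1 - (F : ℂ))))
        = (((√(1 - F))⁻¹ * (2 * (1 - F)) : ℝ) : ℂ) := by push_cast; ring
    rw [this, Complex.ofReal_re]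
    field_simp
    nlinarith

lemma mulVec_eq_sum_eigenvectorBasis {A : Matrix (Fin d) (Fin d) ℂ} (hA : A.IsHermitian)
    (x : EuclideanSpace ℂ (Fin d)) :
    A *ᵥ x.ofLp = (∑ i, (hA.eigenvectorBasis.repr x i * hA.eigenvalues i) •
      hA.eigenvectorBasis i).ofLp := by
  have h : x = ∑ i, hA.eigenvectorBasis.repr x i • hA.eigenvectorBasis i :=
    (hA.eigenvectorBasis.sum_repr x).symm
  conv_lhs => rw [h]
  rw [WithLp.ofLp_sum, WithLp.ofLp_sum, mulVec_sum]
  refine Finset.sum_congr rfl fun i _ ↦ ?_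
  rw [WithLp.ofLp_smul, mulVec_smul, hA.mulVec_eigenvectorBasis, WithLp.ofLp_smul, mul_smul]
  rfl

lemma star_dotProduct_mulVec_eq_sum {A : Matrix (Fin d) (Fin d) ℂ} (hA : A.IsHermitian)
    (x : EuclideanSpace ℂ (Fin d)) :
    (star x.ofLp ⬝ᵥ A *ᵥ x.ofLp).re
      = ∑ i, hA.eigenvalues i * ‖hA.eigenvectorBasis.repr x i‖ ^ 2 := by
  rw [mulVec_eq_sum_eigenvectorBasis hA, star_dotProduct_eq_inner, inner_sum, Complex.re_sum]
  refine Finset.sum_congr rfl fun i _ ↦ ?_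
  rw [inner_smul_right, ← inner_conj_symm, ← OrthonormalBasis.repr_apply_apply]
  have := Complex.mul_conj' (hA.eigenvectorBasis.repr x i)
  rw [mul_right_comm, this]
  rw [← Complex.ofReal_pow, ← Complex.ofReal_mul, Complex.ofReal_re, mul_comm]

lemma sum_repr_norm_sq (B : OrthonormalBasis (Fin d) ℂ (EuclideanSpace ℂ (Fin d)))
    (x : EuclideanSpace ℂ (Fin d)) : ∑ i, ‖B.repr x i‖ ^ 2 = ‖x‖ ^ 2 := by
  rw [← EuclideanSpace.norm_sq_eq, B.repr.norm_map]

lemma sum_eigenvalues_eq_re_trace {A : Matrix (Fin d) (Fin d) ℂ} (hA : A.IsHermitian) :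
    ∑ i, hA.eigenvalues i = A.trace.re := by
  rw [hA.trace_eq_sum_eigenvalues]
  simp

lemma re_dotProduct_mulVec_le_trace {A : Matrix (Fin d) (Fin d) ℂ} (hA : A.PosSemidef)
    (x : EuclideanSpace ℂ (Fin d)) :
    (star x.ofLp ⬝ᵥ A *ᵥ x.ofLp).re ≤ A.trace.re * ‖x‖ ^ 2 := by
  rw [star_dotProduct_mulVec_eq_sum hA.1, ← sum_eigenvalues_eq_re_trace hA.1,
    ← sum_repr_norm_sq hA.1.eigenvectorBasis, Finset.mul_sum]
  refine Finset.sum_le_sum fun i hi ↦ mul_le_mul_of_nonneg_right ?_ (sq_nonneg _)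
  exact Finset.single_le_sum (fun j _ ↦ hA.eigenvalues_nonneg j) hi

/-- For `M` of trace zero, `|M| + M = 2 M⁺` shows that half the trace norm is `tr M⁺`, which
dominates the quadratic form of `M⁺` and hence that of `M`. -/
lemma re_dotProduct_mulVec_le_halfTraceNorm {M : Matrix (Fin d) (Fin d) ℂ} (hM : M.IsHermitian)
    (h0 : M.trace = 0) (x : EuclideanSpace ℂ (Fin d)) :
    (star x.ofLp ⬝ᵥ M *ᵥ x.ofLp).re ≤ halfTraceNorm M * ‖x‖ ^ 2 := by
  have hpos : (M⁺).PosSemidef := nonneg_iff_posSemidef.1 (CFC.posPart_nonneg M)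
  have hneg : (M⁻).PosSemidef := nonneg_iff_posSemidef.1 (CFC.negPart_nonneg M)
  have hsub : M⁺ - M⁻ = M := CFC.posPart_sub_negPart M hM
  have habs : CFC.abs M + M = 2 • M⁺ := CFC.abs_add_self M hM
  have htr : halfTraceNorm M = (M⁺).trace.re := by
    have h1 := congrArg (fun A ↦ (trace A).re) habs
    have h2 : CFC.abs M = CFC.sqrt (M * Mᴴ) := by
      rw [CFC.abs, star_eq_conjTranspose, hM.eq]
    simp only [trace_add, h0, h2, trace_smul] at h1
    simp at h1
    rw [halfTraceNorm, h1]
    ring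
  have h3 := hneg.re_dotProduct_nonneg x.ofLp
  have h4 := re_dotProduct_mulVec_le_trace hpos x
  rw [htr]
  refine le_trans ?_ h4
  conv_lhs => rw [← hsub]
  rw [sub_mulVec, dotProduct_sub, Complex.sub_re]
  have : 0 ≤ (star x.ofLp ⬝ᵥ M⁻ *ᵥ x.ofLp).re := h3
  linarith

/-- A pure state at trace distance less than `ε` from a state `ρ` satisfies
`⟨v, (ρ + ε)⁻¹ v⟩ < 1`. -/
lemma sum_div_lt_one_of_halfTraceNorm_lt {ρ : Matrix (Fin d) (Fin d) ℂ} (hρ : ρ ∈ densityOps d)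
    {v : EuclideanSpace ℂ (Fin d)} (hv : ‖v‖ = 1) {ε : ℝ} (hε : 0 < ε)
    (h : halfTraceNorm (rankOne v - ρ) < ε) :
    ∑ i, ‖hρ.1.1.eigenvectorBasis.repr v i‖ ^ 2 / (hρ.1.1.eigenvalues i + ε) < 1 := by
  have hA := hρ.1.1
  set B := hρ.1.1.eigenvectorBasis with hB
  set p := hρ.1.1.eigenvalues with hp
  have hp0 : ∀ i, 0 < p i + ε := fun i ↦ by
    have := hρ.1.eigenvalues_nonneg i
    positivity
  -- The test vector is `x = (ρ + ε)⁻¹ v`, for which `⟨v, x⟩ = ⟨x, (ρ + ε) x⟩ = S`. Testing `v v† -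
  -- ρ` on it gives `S² - ⟨x, ρ x⟩ < ε ‖x‖²`, that is `S² < S`.
  set c : Fin d → ℂ := fun i ↦ B.repr v i / ((p i + ε : ℝ) : ℂ) with hc
  set x : EuclideanSpace ℂ (Fin d) := B.repr.symm (WithLp.toLp 2 c) with hx
  have hxi : ∀ i, B.repr x i = c i := fun i ↦ by simp [hx]
  have hci : ∀ i, ‖c i‖ ^ 2 = ‖B.repr v i‖ ^ 2 / (p i + ε) ^ 2 := fun i ↦ by
    simp only [hc]
    rw [norm_div, div_pow, Complex.norm_real, Real.norm_of_nonneg (hp0 i).le]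
  set S := ∑ i, ‖B.repr v i‖ ^ 2 / (p i + ε) with hS
  have hinner : inner ℂ v x = (S : ℂ) := by
    rw [← B.repr.inner_map_map, PiLp.inner_apply, hS, Complex.ofReal_sum]
    refine Finset.sum_congr rfl fun i _ ↦ ?_
    rw [hxi, RCLike.inner_apply, hc]
    have := Complex.mul_conj' (B.repr v i)
    rw [div_mul_eq_mul_div, this]
    push_cast
    rfl
  have hquad : (star x.ofLp ⬝ᵥ rankOne v *ᵥ x.ofLp).re = S ^ 2 := by
    rw [rankOne, vecMulVec_mulVec, dotProduct_smul, star_dotProduct_eq_inner,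
      star_dotProduct_eq_inner, ← inner_conj_symm x v, hinner]
    simp [sq]
  have hsum : ∑ i, p i * ‖B.repr x i‖ ^ 2 + ε * ‖x‖ ^ 2 = S := by
    rw [← sum_repr_norm_sq B x, Finset.mul_sum, ← Finset.sum_add_distrib, hS]
    refine Finset.sum_congr rfl fun i _ ↦ ?_
    rw [hxi, hci]
    have := (hp0 i).ne'
    field_simp
  have hS0 : 0 < S := by
    obtain ⟨i, hi⟩ : ∃ i, B.repr v i ≠ 0 := by
      by_contra! h0
      have : ‖v‖ ^ 2 = 0 := by rw [← sum_repr_norm_sq B v]; simp [h0]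
      simp [hv] at this
    refine Finset.sum_pos' (fun i _ ↦ div_nonneg (sq_nonneg _) (hp0 i).le) ⟨i, Finset.mem_univ _, ?_⟩
    have := hp0 i
    positivity
  have hx0 : 0 < ‖x‖ ^ 2 := by
    have : x ≠ 0 := by
      rintro h0
      rw [h0, inner_zero_right] at hinner
      exact hS0.ne (by exact_mod_cast hinner)
    positivity
  have hmain := re_dotProduct_mulVec_le_halfTraceNorm ((rankOne_isHermitian v).sub hA)
    (by rw [trace_sub, trace_rankOne, hv, hρ.2]; simp) x
  rw [sub_mulVec, dotProduct_sub, Complex.sub_re, hquad, star_dotProduct_mulVec_eq_sum hA] at hmain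
  have : S ^ 2 < S := by
    have := mul_lt_mul_of_pos_right h hx0
    linarith
  nlinarith

/-- The eigenvalues lie in `[0, 1]` and satisfy `∑ p = ∑ p² = 1`, so each is `0` or `1`. An
eigenvector for the eigenvalue `1` gives the projection, and `tr (φ - v v†)² = 0`. -/
lemma exists_eq_rankOne_of_mem_pureStates {φ : Matrix (Fin d) (Fin d) ℂ} (hφ : φ ∈ pureStates d) :
    ∃ v : EuclideanSpace ℂ (Fin d), ‖v‖ = 1 ∧ φ = rankOne v := by
  have hA := hφ.1.1.1
  set B := hA.eigenvectorBasis with hB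
  set p := hA.eigenvalues with hp
  have h1 : ∑ i, p i = 1 := by rw [hp, sum_eigenvalues_eq_re_trace, hφ.1.2]; simp
  have h2 : ∑ i, p i * p i = 1 := by
    have h := congrArg Complex.re hφ.2
    conv_lhs at h => rw [hA.spectral_theorem]
    rw [← map_mul, Unitary.conjStarAlgAut_apply, trace_mul_cycle, ← mul_assoc] at h
    simp [diagonal_mul_diagonal, trace_diagonal] at h
    simpa using h
  have h0 : ∀ i, 0 ≤ p i := hφ.1.1.eigenvalues_nonneg
  have hle : ∀ i, p i ≤ 1 := fun i ↦ by
    rw [← h1]; exact Finset.single_le_sum (fun j _ ↦ h0 j) (Finset.mem_univ i)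
  have h3 : ∑ i, p i * (1 - p i) = 0 := by
    simp only [mul_sub, Finset.sum_sub_distrib, mul_one, h1, h2, sub_self]
  have h4 : ∀ i, p i * (1 - p i) = 0 := fun i ↦
    (Finset.sum_eq_zero_iff_of_nonneg fun i _ ↦ mul_nonneg (h0 i) (sub_nonneg.2 (hle i))).1 h3 i
      (Finset.mem_univ i)
  obtain ⟨i, hi⟩ : ∃ i, p i ≠ 0 := by
    by_contra! h
    simp [h] at h1
  have hpi : p i = 1 := by
    have := (mul_eq_zero.1 (h4 i)).resolve_left hi
    linarith
  have hBi : ‖B i‖ = 1 := B.norm_eq_one i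
  refine ⟨B i, hBi, ?_⟩
  have hmul : φ * rankOne (B i) = rankOne (B i) := by
    rw [rankOne, mul_vecMulVec, hA.mulVec_eigenvectorBasis, ← hp, hpi, one_smul]
  have hmul' : rankOne (B i) * φ = rankOne (B i) := by
    have := congrArg conjTranspose hmul
    rwa [conjTranspose_mul, (rankOne_isHermitian _).eq, hA.eq] at this
  have hH : (φ - rankOne (B i))ᴴ = φ - rankOne (B i) := (hA.sub (rankOne_isHermitian _)).eq
  rw [← sub_eq_zero, ← trace_conjTranspose_mul_self_eq_zero_iff, hH]
  simp only [sub_mul, mul_sub, hmul, hmul', rankOne_mul_self hBi, trace_sub, hφ.2, trace_rankOne,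
    hBi]
  simp

end TraceNorm

/-! ### Measure of the cones and lower bounds -/

section Cones

open MeasureTheory Matrix

/-- The quotient is a factor `c / (c + b_j)` of the cone measure: `x` is one small eigenvalue of
`ρ`, and `q` is the sum of all eigenvalues but the largest. -/
lemma capFactor_le {q ε x : ℝ} (hx : 0 ≤ x) (hxq : x ≤ q) (hq : q < ε) (hε : ε ≤ 1 / 2) :
    (ε - q) * (ε + x) / (1 - q - x) ≤ (2 * ε) ^ 2 := by
  rw [div_le_iff₀ (by linarith)]
  have h1 : ε - q ≤ 2 * ε * (1 - q - x) := by nlinarith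
  have h2 : ε + x ≤ 2 * ε := by linarith
  calc (ε - q) * (ε + x) ≤ (2 * ε * (1 - q - x)) * (2 * ε) :=
        mul_le_mul h1 h2 (by linarith) (by nlinarith)
    _ = _ := by ring

/-- The right side is the chord over `[0, q]` of a convex function of `x`. Being affine, it sums to
a quantity depending on `∑ x_j = q` only. -/
lemma capFactor_le_chord {q ε x : ℝ} (hx : 0 ≤ x) (hxq : x ≤ q) (hq : q < ε) (hε : ε ≤ 1 / 2) :
    (ε - q) * (ε + x) / (1 - q - x)
      ≤ (ε - q) * ε / (1 - q) + x * ((ε - q) * (1 - q + ε) / ((1 - q) * (1 - 2 * q))) := by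
  have h1 : 0 < 1 - q - x := by linarith
  have h2 : 0 < 1 - q := by linarith
  have h3 : 0 < 1 - 2 * q := by linarith
  have h : (ε - q) * (ε + x) / (1 - q - x)
      = (ε - q) * ε / (1 - q) + x * ((ε - q) * (1 - q + ε) / ((1 - q) * (1 - q - x))) := by
    field_simp
    ring
  have h4 : (ε - q) * (1 - q + ε) / ((1 - q) * (1 - q - x))
      ≤ (ε - q) * (1 - q + ε) / ((1 - q) * (1 - 2 * q)) :=
    div_le_div_of_nonneg_left (mul_nonneg (by linarith) (by linarith)) (by positivity)
      (mul_le_mul_of_nonneg_left (by linarith) h2.le)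
  rw [h]
  linarith [mul_le_mul_of_nonneg_left h4 hx]

lemma chord_sum_le {q ε m : ℝ} (hq0 : 0 ≤ q) (hq : q < ε) (hε : ε ≤ 1 / 2) (hm : 3 ≤ m) :
    m * ((ε - q) * ε / (1 - q)) + q * ((ε - q) * (1 - q + ε) / ((1 - q) * (1 - 2 * q)))
      ≤ m * ε ^ 2 := by
  have h2 : 0 < 1 - q := by linarith
  have h3 : 0 < 1 - 2 * q := by linarith
  have hA : (ε - q) * ε / (1 - q) ≤ ε ^ 2 := by
    rw [div_le_iff₀ h2]
    nlinarith [mul_nonneg (mul_nonneg hq0 (hq0.trans hq.le)) (sub_nonneg.2 hε)]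
  have h : 3 * ((ε - q) * ε / (1 - q)) + q * ((ε - q) * (1 - q + ε) / ((1 - q) * (1 - 2 * q)))
      ≤ 3 * ε ^ 2 := by
    have : 3 * ((ε - q) * ε / (1 - q)) + q * ((ε - q) * (1 - q + ε) / ((1 - q) * (1 - 2 * q)))
        = (3 * (ε - q) * ε * (1 - 2 * q) + q * (ε - q) * (1 - q + ε)) / ((1 - q) * (1 - 2 * q)) := by
      have h4 : 1 - q * 2 ≠ 0 := by linarith
      field_simp
    rw [this, div_le_iff₀ (by positivity)]
    -- The difference of the two sides after clearing denominators.
    have key : 0 ≤ q * ((1 - 2 * ε) * (2 * ε + q * (1 - 3 * ε)) + q * (ε - q)) := by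
      have h5 : 0 ≤ 2 * ε + q * (1 - 3 * ε) := by nlinarith
      have h6 := mul_nonneg (by linarith : 0 ≤ 1 - 2 * ε) h5
      have h7 := mul_nonneg hq0 (sub_nonneg.2 hq.le)
      positivity
    nlinarith [key]
  -- Each unit of `m` beyond `3` adds at most `ε ^ 2` on the left, by `hA`.
  nlinarith [mul_nonneg (sub_nonneg.2 hm) (sub_nonneg.2 hA)]

/-- The chord bound makes the mean of the factors at most `ε ^ 2`. The passage to the product is the
AM-GM inequality, in the form `t ≤ exp (t - 1)`. -/
lemma prod_capFactor_le {n : ℕ} (hn : 3 ≤ n) {q ε : ℝ} (x : Fin n → ℝ) (hx : ∀ j, 0 ≤ x j)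
    (hsum : ∑ j, x j = q) (hq : q < ε) (hε : ε ≤ 1 / 2) :
    ∏ j, (ε - q) * (ε + x j) / (1 - q - x j) ≤ ε ^ (2 * n) := by
  have hq0 : 0 ≤ q := hsum ▸ Finset.sum_nonneg fun j _ ↦ hx j
  have hε0 : 0 < ε := hq0.trans_lt hq
  have hxq : ∀ j, x j ≤ q := fun j ↦
    hsum ▸ Finset.single_le_sum (fun j _ ↦ hx j) (Finset.mem_univ j)
  set z : Fin n → ℝ := fun j ↦ (ε - q) * (ε + x j) / (1 - q - x j) with hz
  have hz0 : ∀ j, 0 ≤ z j := fun j ↦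
    div_nonneg (mul_nonneg (by linarith) (by linarith [hx j])) (by linarith [hxq j])
  have hzsum : ∑ j, z j ≤ n * ε ^ 2 := by
    refine (Finset.sum_le_sum fun j _ ↦ capFactor_le_chord (hx j) (hxq j) hq hε).trans ?_
    rw [Finset.sum_add_distrib, ← Finset.sum_mul, hsum, Finset.sum_const, Finset.card_univ,
      Fintype.card_fin, nsmul_eq_mul]
    exact chord_sum_le hq0 hq hε (by exact_mod_cast hn)
  have hstep : ∀ j, z j ≤ ε ^ 2 * Real.exp (z j / ε ^ 2 - 1) := fun j ↦ by
    have := Real.add_one_le_exp (z j / ε ^ 2 - 1)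
    rw [sub_add_cancel, div_le_iff₀' (by positivity)] at this
    exact this
  calc ∏ j, z j ≤ ∏ j, ε ^ 2 * Real.exp (z j / ε ^ 2 - 1) :=
        Finset.prod_le_prod (fun j _ ↦ hz0 j) fun j _ ↦ hstep j
    _ = ε ^ (2 * n) * Real.exp ((∑ j, z j) / ε ^ 2 - n) := by
        rw [Finset.prod_mul_distrib, ← Real.exp_sum, Finset.sum_sub_distrib, Finset.sum_div]
        simp [pow_mul]
    _ ≤ ε ^ (2 * n) * 1 := by
        gcongr
        rw [Real.exp_le_one_iff, sub_nonpos, div_le_iff₀ (by positivity)]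
        exact hzsum
    _ = _ := mul_one _

lemma prod_capFactor_le_two_mul {n : ℕ} {q ε : ℝ} (x : Fin n → ℝ) (hx : ∀ j, 0 ≤ x j)
    (hsum : ∑ j, x j = q) (hq : q < ε) (hε : ε ≤ 1 / 2) :
    ∏ j, (ε - q) * (ε + x j) / (1 - q - x j) ≤ (2 * ε) ^ (2 * n) := by
  have hxq : ∀ j, x j ≤ q := fun j ↦
    hsum ▸ Finset.single_le_sum (fun j _ ↦ hx j) (Finset.mem_univ j)
  calc ∏ j, (ε - q) * (ε + x j) / (1 - q - x j) ≤ ∏ _j : Fin n, (2 * ε) ^ 2 :=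
        Finset.prod_le_prod (fun j _ ↦ div_nonneg (mul_nonneg (by linarith)
          (by linarith [hx j, hxq j])) (by linarith [hxq j]))
          fun j _ ↦ capFactor_le (hx j) (hxq j) hq hε
    _ = _ := by simp [pow_mul]

/-- The cone over the set of pure states `v v†` with `⟨v, (ρ + ε)⁻¹ v⟩ < 1`, where `ρ` is the
operator with eigenbasis `B` and eigenvalues `p`. -/
def stateCone {d : ℕ} (B : OrthonormalBasis (Fin d) ℂ (EuclideanSpace ℂ (Fin d))) (p : Fin d → ℝ)
    (ε : ℝ) : Set (EuclideanSpace ℂ (Fin d)) :=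
  {v | ∑ i, ‖B.repr v i‖ ^ 2 / (p i + ε) < ∑ i, ‖B.repr v i‖ ^ 2}

/-- Since `ε ≤ 1 / 2` and the trace is one, at most one `p i + ε` exceeds `1`. If none does, the
cone is empty; otherwise only coordinate `i` enters with the favourable sign and the product formula
applies. `K` is left open to serve both lower bounds. -/
lemma gaussian_stateCone_le {n : ℕ}
    (B : OrthonormalBasis (Fin (n + 1)) ℂ (EuclideanSpace ℂ (Fin (n + 1))))
    {p : Fin (n + 1) → ℝ} (hp : ∀ i, 0 ≤ p i) (hsum : ∑ i, p i = 1) {ε : ℝ} (hε₀ : 0 < ε)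
    (hε : ε ≤ 1 / 2) {K : ℝ} (hK : ∀ (q : ℝ) (x : Fin n → ℝ), (∀ j, 0 ≤ x j) → ∑ j, x j = q →
      q < ε → ∏ j, (ε - q) * (ε + x j) / (1 - q - x j) ≤ K) :
    gaussian (n + 1) (stateCone B p ε) ≤ ENNReal.ofReal K := by
  have hpε : ∀ i, 0 < p i + ε := fun i ↦ by linarith [hp i]
  by_cases hcase : ∀ i, p i + ε ≤ 1
  · have : stateCone B p ε = ∅ := by
      refine Set.eq_empty_of_forall_notMem fun v hv ↦ ?_
      simp only [stateCone, Set.mem_ofPred_eq] at hv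
      refine hv.not_ge (Finset.sum_le_sum fun i _ ↦ ?_)
      rw [le_div_iff₀ (hpε i)]
      exact mul_le_of_le_one_right (sq_nonneg _) (hcase i)
    simp [this]
  push Not at hcase
  obtain ⟨i, hi⟩ := hcase
  set x : Fin n → ℝ := fun j ↦ p (i.succAbove j) with hx
  have hxsum : ∑ j, x j = 1 - p i := by
    rw [Fin.sum_univ_succAbove _ i] at hsum
    linarith
  have hxle : ∀ j, x j ≤ 1 - p i := fun j ↦
    hxsum ▸ Finset.single_le_sum (fun j _ ↦ hp _) (Finset.mem_univ j)
  set c : ℝ := 1 - 1 / (p i + ε) with hc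
  set b : Fin n → ℝ := fun j ↦ 1 / (x j + ε) - 1 with hb
  have hc0 : 0 < c := by
    rw [hc, sub_pos, div_lt_one (hpε i)]
    exact hi
  have hb0 : ∀ j, 0 ≤ b j := fun j ↦ by
    rw [hb, sub_nonneg, le_div_iff₀ (hpε _)]
    linarith [hxle j]
  have hset : stateCone B p ε
      = {v | ∑ j, b j * ‖B.repr v (i.succAbove j)‖ ^ 2 < c * ‖B.repr v i‖ ^ 2} := by
    ext v
    simp only [stateCone, Set.mem_ofPred_eq]
    rw [Fin.sum_univ_succAbove _ i, Fin.sum_univ_succAbove _ i, ← sub_pos, ← sub_pos (b := ∑ j, _)]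
    have : ∑ j, b j * ‖B.repr v (i.succAbove j)‖ ^ 2
        = ∑ j, ‖B.repr v (i.succAbove j)‖ ^ 2 / (p (i.succAbove j) + ε)
          - ∑ j, ‖B.repr v (i.succAbove j)‖ ^ 2 := by
      rw [← Finset.sum_sub_distrib]
      refine Finset.sum_congr rfl fun j _ ↦ ?_
      simp only [hb, hx]
      ring
    rw [this, hc]
    ring_nf
  rw [hset, gaussian_quadratic B i b hb0 hc0]
  refine ENNReal.ofReal_le_ofReal ?_
  refine le_trans (le_of_eq (Finset.prod_congr rfl fun j _ ↦ ?_))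
    (hK (1 - p i) x (fun j ↦ hp _) hxsum (by linarith))
  have h1 : x j + ε ≠ 0 := (hpε _).ne'
  have h2 : p i + ε ≠ 0 := (hpε _).ne'
  have h3 : p i - x j ≠ 0 := by
    have := hxle j
    intro h
    linarith
  have h4 : c + b j = (p i - x j) / ((p i + ε) * (x j + ε)) := by
    simp only [hc, hb]
    field_simp
    ring
  rw [h4, hc]
  have h5 : 1 - (1 - p i) - x j = p i - x j := by ring
  rw [h5]
  field_simp
  ring

lemma gaussian_coord_pos (n : ℕ) :
    gaussian (n + 1) {v | 0 < ‖v 0‖ ^ 2} = 1 := by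
  have := gaussian_quadratic (EuclideanSpace.basisFun (Fin (n + 1)) ℂ) 0 (fun _ : Fin n ↦ 0)
    (fun _ ↦ le_rfl) one_pos
  simpa using this

lemma exists_halfTraceNorm_lt {d : ℕ} {ε : ℝ} {X : Type*} {ρ : X → Matrix (Fin d) (Fin d) ℂ}
    (h : IsExternalCovering d ε ρ) {φ : Matrix (Fin d) (Fin d) ℂ} (hφ : φ ∈ pureStates d) :
    ∃ x, halfTraceNorm (φ - ρ x) < ε := by
  have := (le_iSup (fun φ : pureStates d ↦ ⨅ x : X, ENNReal.ofReal (halfTraceNorm (φ.1 - ρ x)))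
    ⟨φ, hφ⟩).trans_lt h.2
  obtain ⟨x, hx⟩ := iInf_lt_iff.1 this
  exact ⟨x, (ENNReal.ofReal_lt_ofReal_iff'.1 hx).1⟩

lemma one_le_mul_of_mem_encodingSizes {n N : ℕ} {ε : ℝ} (hε₀ : 0 < ε)
    (hε : ε ≤ 1 / 2) (hN : N ∈ encodingSizes (n + 1) ε) {K : ℝ}
    (hK : ∀ (q : ℝ) (x : Fin n → ℝ), (∀ j, 0 ≤ x j) → ∑ j, x j = q →
      q < ε → ∏ j, (ε - q) * (ε + x j) / (1 - q - x j) ≤ K) :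
    1 ≤ N * K := by
  obtain ⟨ρ, hρ⟩ := hN
  set C : Fin N → Set (EuclideanSpace ℂ (Fin (n + 1))) := fun x ↦
    stateCone (hρ.1 x).1.1.eigenvectorBasis (hρ.1 x).1.1.eigenvalues ε with hC
  -- A set of full measure that avoids the zero vector, so that its elements can be normalised.
  have hcover : {v : EuclideanSpace ℂ (Fin (n + 1)) | 0 < ‖v 0‖ ^ 2} ⊆ ⋃ x, C x := by
    intro v hv
    have hv0 : v ≠ 0 := by
      rintro rfl
      simp at hv
    have hnorm : 0 < ‖v‖ := norm_pos_iff.2 hv0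
    set u : EuclideanSpace ℂ (Fin (n + 1)) := ((‖v‖⁻¹ : ℝ) : ℂ) • v with hu
    have hu1 : ‖u‖ = 1 := by
      rw [hu, norm_smul, Complex.norm_real, norm_inv, norm_norm, inv_mul_cancel₀ hnorm.ne']
    obtain ⟨x, hx⟩ := exists_halfTraceNorm_lt hρ (rankOne_mem_pureStates hu1)
    refine Set.mem_iUnion.2 ⟨x, ?_⟩
    have h := sum_div_lt_one_of_halfTraceNorm_lt (hρ.1 x) hu1 hε₀ hx
    simp only [hC, stateCone, Set.mem_ofPred_eq]
    set B := (hρ.1 x).1.1.eigenvectorBasis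
    rw [sum_repr_norm_sq B]
    have h2 : ∀ i, ‖B.repr u i‖ ^ 2 = ‖B.repr v i‖ ^ 2 / ‖v‖ ^ 2 := fun i ↦ by
      rw [hu, map_smul]
      simp [mul_pow]
      field_simp
    simp_rw [h2, div_right_comm _ (‖v‖ ^ 2)] at h
    rwa [← Finset.sum_div, div_lt_one (by positivity)] at h
  have h1 : (1 : ENNReal) ≤ N * ENNReal.ofReal K := by
    calc (1 : ENNReal) = gaussian (n + 1) {v | 0 < ‖v 0‖ ^ 2} := (gaussian_coord_pos n).symm
      _ ≤ gaussian (n + 1) (⋃ x, C x) := measure_mono hcover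
      _ ≤ ∑ x, gaussian (n + 1) (C x) := measure_iUnion_fintype_le _ _
      _ ≤ ∑ _x : Fin N, ENNReal.ofReal K := by
          refine Finset.sum_le_sum fun x _ ↦ gaussian_stateCone_le _
            (hρ.1 x).1.eigenvalues_nonneg ?_ hε₀ hε hK
          rw [sum_eigenvalues_eq_re_trace, (hρ.1 x).2]
          simp
      _ = N * ENNReal.ofReal K := by simp
  rw [← ENNReal.ofReal_natCast, ← ENNReal.ofReal_mul (Nat.cast_nonneg _),
    ENNReal.one_le_ofReal] at h1
  exact h1

/-- The Gaussian measure of the cone over a ball of pure states. -/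
lemma gaussian_rayDist_lt {n : ℕ} {w : EuclideanSpace ℂ (Fin (n + 1))} (hw : w ≠ 0) {r : ℝ}
    (hr₀ : 0 < r) (hr : r ≤ 1) :
    gaussian (n + 1) {v | v ≠ 0 ∧ rayDist w v < r} = ENNReal.ofReal (r ^ (2 * n)) := by
  have hnorm : 0 < ‖w‖ := norm_pos_iff.2 hw
  have hc : ((‖w‖⁻¹ : ℝ) : ℂ) ≠ 0 := by simpa using hw
  set u : EuclideanSpace ℂ (Fin (n + 1)) := ((‖w‖⁻¹ : ℝ) : ℂ) • w with hu
  have hu1 : ‖u‖ = 1 := by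
    rw [hu, norm_smul, Complex.norm_real, norm_inv, norm_norm, inv_mul_cancel₀ hnorm.ne']
  obtain ⟨B, hB⟩ := Orthonormal.exists_orthonormalBasis_extension_of_card_eq (𝕜 := ℂ)
    (ι := Fin (n + 1)) (by simp) (v := fun _ ↦ u) (s := {0}) (by
      constructor
      · intro i; exact hu1
      · intro i j hij; exact absurd (Subsingleton.elim i j) hij)
  have hB0 : B 0 = u := hB 0 rfl
  -- In a basis starting with `u`, all coefficients are equal and each factor is `r² / (r² + (1 -
  -- r²)) = r²`.
  have hset : {v | v ≠ 0 ∧ rayDist w v < r}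
      = {v | ∑ j : Fin n, (1 - r ^ 2) * ‖B.repr v ((0 : Fin (n + 1)).succAbove j)‖ ^ 2
          < r ^ 2 * ‖B.repr v 0‖ ^ 2} := by
    ext v
    simp only [Set.mem_ofPred_eq]
    have hsum := sum_repr_norm_sq B v
    rw [Fin.sum_univ_succAbove _ 0] at hsum
    rw [← Finset.mul_sum, ← rayDist_smul_left hc w v, ← hu, rayDist, hu1,
      Real.sqrt_lt' hr₀, ← hB0, ← B.repr_apply_apply, one_pow, one_mul]
    by_cases hv : v = 0
    · simp [hv]
    · have hv2 : 0 < ‖v‖ ^ 2 := by positivity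
      simp only [ne_eq, hv, not_false_eq_true, true_and]
      rw [sub_lt_comm, lt_div_iff₀ hv2, ← hsum]
      constructor <;> intro h <;> linarith
  have hr2 : r ^ 2 ≤ 1 := pow_le_one₀ hr₀.le hr
  rw [hset, gaussian_quadratic B 0 _ (fun _ ↦ by linarith) (by positivity)]
  simp [pow_mul]

end Cones

/-! ### Greedy covering completed by a packing -/

section Covering

open MeasureTheory

variable {Ω : Type*} [MeasurableSpace Ω] {μ : Measure Ω} [IsProbabilityMeasure μ] {D : Ω → Ω → ℝ}

/-- Averaging over the centre: some ball captures at least the expected part of a given set. -/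
lemma exists_mul_le_measureReal_inter_ball (hD : Measurable fun p : Ω × Ω ↦ D p.1 p.2)
    (hsymm : ∀ x y, D x y = D y x) {r V : ℝ} (hV : 0 ≤ V)
    (hball : ∀ x, μ {y | D x y < r} = ENNReal.ofReal V) {U : Set Ω} (hU : MeasurableSet U) :
    ∃ w, V * μ.real U ≤ μ.real (U ∩ {x | D w x < r}) := by
  set S : Set (Ω × Ω) := {p | p.2 ∈ U ∧ D p.1 p.2 < r} with hS
  have hSm : MeasurableSet S :=
    (measurable_snd hU).inter (measurableSet_lt hD measurable_const)
  have h1 : (μ.prod μ) S = ∫⁻ w, μ (U ∩ {x | D w x < r}) ∂μ := Measure.prod_apply hSm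
  have h2 : (μ.prod μ) S = ENNReal.ofReal V * μ U := by
    rw [Measure.prod_apply_symm hSm]
    have : ∀ y, μ ((fun x ↦ (x, y)) ⁻¹' S) = U.indicator (fun _ ↦ ENNReal.ofReal V) y := by
      intro y
      by_cases hy : y ∈ U
      · rw [Set.indicator_of_mem hy, ← hball y]
        congr 1
        ext x
        simp [hS, hy, hsymm x y]
      · rw [Set.indicator_of_notMem hy]
        convert measure_empty (μ := μ)
        ext x
        simp [hS, hy]
    simp_rw [this]
    rw [lintegral_indicator_const hU]
  have hne : ∫⁻ w, μ (U ∩ {x | D w x < r}) ∂μ ≠ ⊤ := by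
    rw [← h1]; exact measure_ne_top _ _
  obtain ⟨w, hw⟩ := exists_lintegral_le (μ := μ) hne
  refine ⟨w, ?_⟩
  rw [← h1, h2] at hw
  have := ENNReal.toReal_mono (measure_ne_top _ _) hw
  rwa [ENNReal.toReal_mul, ENNReal.toReal_ofReal hV] at this

lemma measurableSet_forall_le (hD : Measurable fun p : Ω × Ω ↦ D p.1 p.2) (C : Finset Ω) (r : ℝ) :
    MeasurableSet {x | ∀ c ∈ C, r ≤ D c x} := by
  have : {x | ∀ c ∈ C, r ≤ D c x} = ⋂ c ∈ C, {x | r ≤ D c x} := by ext x; simp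
  rw [this]
  exact C.measurableSet_biInter fun c _ ↦
    measurableSet_le measurable_const (hD.comp measurable_prodMk_left)

/-- Greedily chosen balls leave at most the part `(1 - V) ^ M` of the space uncovered. -/
lemma exists_measureReal_uncovered_le (hD : Measurable fun p : Ω × Ω ↦ D p.1 p.2)
    (hsymm : ∀ x y, D x y = D y x) {r V : ℝ} (hV : 0 ≤ V)
    (hball : ∀ x, μ {y | D x y < r} = ENNReal.ofReal V) (hV1 : V ≤ 1) (M : ℕ) :
    ∃ C : Finset Ω, C.card ≤ M ∧ μ.real {x | ∀ c ∈ C, r ≤ D c x} ≤ (1 - V) ^ M := by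
  classical
  induction M with
  | zero => exact ⟨∅, by simp⟩
  | succ M ih =>
    obtain ⟨C, hC, hU⟩ := ih
    set U := {x | ∀ c ∈ C, r ≤ D c x} with hUdef
    obtain ⟨w, hw⟩ := exists_mul_le_measureReal_inter_ball hD hsymm hV hball
      (measurableSet_forall_le hD C r)
    refine ⟨insert w C, (Finset.card_insert_le _ _).trans (by omega), ?_⟩
    have hset : {x | ∀ c ∈ insert w C, r ≤ D c x} = U \ {x | D w x < r} := by
      ext x
      simp [hUdef, and_comm]
    have hsplit := measureReal_inter_add_sdiff (μ := μ) (s := U)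
      (measurableSet_lt (hD.comp measurable_prodMk_left) measurable_const :
        MeasurableSet {x | D w x < r})
    rw [hset, pow_succ]
    have : μ.real U * (1 - V) ≤ (1 - V) ^ M * (1 - V) :=
      mul_le_mul_of_nonneg_right hU (by linarith)
    linarith

/-- A set of points at mutual distances at least `2 * δ`, whose `δ`-balls lie in `U`, has at most
`μ U / V` elements, where `V` is the measure of a `δ`-ball. -/
lemma card_mul_le_of_separated (hD : Measurable fun p : Ω × Ω ↦ D p.1 p.2)
    (hsymm : ∀ x y, D x y = D y x) (htri : ∀ x y z, D x z ≤ D x y + D y z) {δ V : ℝ} (hV : 0 ≤ V)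
    (hball : ∀ x, μ {y | D x y < δ} = ENNReal.ofReal V) {U : Set Ω} (P : Finset Ω)
    (hPU : ∀ p ∈ P, ∀ y, D p y < δ → y ∈ U)
    (hsep : ∀ p ∈ P, ∀ p' ∈ P, p ≠ p' → 2 * δ ≤ D p p') :
    P.card * V ≤ μ.real U := by
  have hdisj : (P : Set Ω).PairwiseDisjoint fun p ↦ {y | D p y < δ} := by
    intro p hp p' hp' hne
    refine Set.disjoint_left.2 fun y hy hy' ↦ ?_
    simp only [Set.mem_ofPred_eq] at hy hy'
    have h1 := hsep p hp p' hp' hne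
    have h2 := htri p y p'
    rw [hsymm y p'] at h2
    linarith
  have hm : ∀ p ∈ P, MeasurableSet {y | D p y < δ} := fun p _ ↦
    measurableSet_lt (hD.comp measurable_prodMk_left) measurable_const
  have h := measureReal_biUnion_finset (μ := μ) hdisj hm
  have hb : ∀ p, μ.real {y | D p y < δ} = V := fun p ↦ by
    rw [Measure.real, hball, ENNReal.toReal_ofReal hV]
  simp only [hb, Finset.sum_const, nsmul_eq_mul] at h
  rw [← h]
  exact measureReal_mono (Set.iUnion₂_subset fun p hp y hy ↦ hPU p hp y hy)

/-- Covering by `M` greedily chosen balls, completed by a packing of the points that are far away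
from all of their centres. -/
lemma exists_covering (hD : Measurable fun p : Ω × Ω ↦ D p.1 p.2) (hself : ∀ x, D x x = 0)
    (hsymm : ∀ x y, D x y = D y x) (htri : ∀ x y z, D x z ≤ D x y + D y z) {r δ V W : ℝ}
    (hV : 0 ≤ V) (hballr : ∀ x, μ {y | D x y < r} = ENNReal.ofReal V) (hV1 : V ≤ 1)
    (hW : 0 < W) (hballδ : ∀ x, μ {y | D x y < δ} = ENNReal.ofReal W) (hδ : 0 < δ) (hδr : δ ≤ r)
    (M : ℕ) :
    ∃ C : Finset Ω, (C.card : ℝ) ≤ M + (1 - V) ^ M / W ∧ ∀ x, ∃ c ∈ C, D c x < r + δ := by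
  classical
  obtain ⟨C, hC, hU⟩ := exists_measureReal_uncovered_le hD hsymm hV hballr hV1 M
  -- The volume bound `hcard` limits the size of good sets, so one of maximal cardinality exists.
  set good : Finset Ω → Prop := fun P ↦ (∀ p ∈ P, ∀ c ∈ C, r + δ ≤ D c p) ∧
    ∀ p ∈ P, ∀ p' ∈ P, p ≠ p' → 2 * δ ≤ D p p' with hgood
  have hcard : ∀ P, good P → (P.card : ℝ) ≤ (1 - V) ^ M / W := by
    intro P hP
    rw [le_div_iff₀ hW]
    refine le_trans ?_ hU
    refine card_mul_le_of_separated hD hsymm htri hW.le hballδ P (fun p hp y hy c hc ↦ ?_) hP.2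
    have h1 := hP.1 p hp c hc
    have h2 := htri c y p
    rw [hsymm y p] at h2
    linarith
  have hbdd : BddAbove {k | ∃ P, good P ∧ P.card = k} := by
    refine ⟨⌊(1 - V) ^ M / W⌋₊, ?_⟩
    rintro k ⟨P, hP, rfl⟩
    exact Nat.le_floor (hcard P hP)
  have hne : {k | ∃ P, good P ∧ P.card = k}.Nonempty := ⟨0, ∅, by simp [hgood], rfl⟩
  obtain ⟨P, hP, hPmax⟩ := Nat.sSup_mem hne hbdd
  refine ⟨C ∪ P, ?_, fun x ↦ ?_⟩
  · calc ((C ∪ P).card : ℝ) ≤ (C.card + P.card : ℕ) := by exact_mod_cast Finset.card_union_le _ _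
      _ ≤ M + (1 - V) ^ M / W := by
        push_cast
        exact add_le_add (by exact_mod_cast hC) (hcard P hP)
  · by_contra! hx
    have hxP : x ∉ P := fun h ↦ by
      have := hx x (Finset.mem_union_right _ h)
      rw [hself] at this
      linarith
    -- Here `δ ≤ r` gives `2 * δ ≤ r + δ`, so an uncovered `x` could be added to `P`, against
    -- maximality.
    have hfar : ∀ p ∈ P, 2 * δ ≤ D p x := fun p hp ↦ by
      linarith [hx p (Finset.mem_union_right _ hp)]
    have hins : good (insert x P) := by
      refine ⟨fun p hp c hc ↦ ?_, fun p hp p' hp' hne ↦ ?_⟩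
      · rcases Finset.mem_insert.1 hp with rfl | hp
        · exact hx c (Finset.mem_union_left _ hc)
        · exact hP.1 p hp c hc
      · rcases Finset.mem_insert.1 hp with rfl | hp <;>
          rcases Finset.mem_insert.1 hp' with rfl | hp'
        · exact absurd rfl hne
        · rw [hsymm]; exact hfar p' hp'
        · exact hfar p ‹p ∈ P›
        · exact hP.2 p ‹p ∈ P› p' ‹p' ∈ P› hne
    have := le_csSup hbdd ⟨insert x P, hins, rfl⟩
    rw [← hPmax, Finset.card_insert_of_notMem hxP] at this
    omega

end Covering

/-! ### From coverings to the upper bound -/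

section Bounds

open MeasureTheory

/-- The Gaussian measure on the nonzero vectors. -/
def gaussianNeZero (d : ℕ) : Measure {v : EuclideanSpace ℂ (Fin d) // v ≠ 0} :=
  (gaussian d).comap Subtype.val

lemma gaussianNeZero_apply {d : ℕ} (S : Set (EuclideanSpace ℂ (Fin d))) :
    gaussianNeZero d {v | (v : EuclideanSpace ℂ (Fin d)) ∈ S} = gaussian d {v | v ≠ 0 ∧ v ∈ S} := by
  have hval : MeasurableEmbedding (Subtype.val : {v : EuclideanSpace ℂ (Fin d) // v ≠ 0} → _) :=
    MeasurableEmbedding.subtype_coe (measurableSet_singleton 0).compl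
  rw [gaussianNeZero, hval.comap_apply]
  congr 1
  ext v
  simp [and_comm]

instance (n : ℕ) : IsProbabilityMeasure (gaussianNeZero (n + 1)) := by
  constructor
  have h := gaussianNeZero_apply (d := n + 1) Set.univ
  simp only [Set.mem_univ, Set.ofPred_true, and_true] at h
  rw [h]
  refine le_antisymm prob_le_one ?_
  rw [← gaussian_coord_pos n]
  refine measure_mono fun v hv ↦ ?_
  simp only [Set.mem_ofPred_eq] at hv ⊢
  rintro rfl
  simp at hv

/-- The slack `R < ε` is needed because pointwise strict bounds only give a supremum at most `R`. -/
lemma mem_encodingSizes_of_rayDist_lt {d : ℕ} {R ε : ℝ} (hR : R < ε) (hε : 0 < ε)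
    (C : Finset {v : EuclideanSpace ℂ (Fin d) // v ≠ 0})
    (hC : ∀ x : {v : EuclideanSpace ℂ (Fin d) // v ≠ 0}, ∃ c ∈ C, rayDist c.1 x.1 < R) :
    C.card ∈ encodingSizes d ε := by
  have hunit : ∀ v : {v : EuclideanSpace ℂ (Fin d) // v ≠ 0},
      ‖((‖v.1‖⁻¹ : ℝ) : ℂ) • v.1‖ = 1 ∧ ((‖v.1‖⁻¹ : ℝ) : ℂ) ≠ 0 := fun v ↦ by
    have : ‖v.1‖ ≠ 0 := norm_ne_zero_iff.2 v.2
    refine ⟨?_, by simpa using v.2⟩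
    rw [norm_smul, Complex.norm_real, norm_inv, norm_norm, inv_mul_cancel₀ this]
  refine ⟨fun i ↦ rankOne (((‖(C.equivFin.symm i).1.1‖⁻¹ : ℝ) : ℂ) • (C.equivFin.symm i).1.1),
    fun i ↦ (rankOne_mem_pureStates (hunit _).1).1, ?_⟩
  refine lt_of_le_of_lt (iSup_le fun φ ↦ ?_) ((ENNReal.ofReal_lt_ofReal_iff hε).2 hR)
  obtain ⟨v, hv, hφ⟩ := exists_eq_rankOne_of_mem_pureStates φ.2
  obtain ⟨c, hc, hlt⟩ := hC ⟨v, by rintro rfl; simp at hv⟩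
  refine iInf_le_of_le (C.equivFin ⟨c, hc⟩) (ENNReal.ofReal_le_ofReal ?_)
  simp only [Equiv.symm_apply_apply]
  rw [hφ, halfTraceNorm_rankOne_sub hv (hunit c).1,
    rayDist_smul_right (hunit c).2, rayDist_comm]
  exact hlt.le

lemma exists_mem_encodingSizes_le {n : ℕ} {r δ ε : ℝ} (hδ : 0 < δ) (hδr : δ ≤ r)
    (hr : r ≤ 1) (hε : r + δ < ε) (M : ℕ) :
    ∃ N ∈ encodingSizes (n + 1) ε,
      (N : ℝ) ≤ M + (1 - r ^ (2 * n)) ^ M / δ ^ (2 * n) := by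
  have hr0 : 0 < r := hδ.trans_le hδr
  have hball : ∀ s : ℝ, 0 < s → s ≤ 1 → ∀ x : {v : EuclideanSpace ℂ (Fin (n + 1)) // v ≠ 0},
      gaussianNeZero (n + 1) {y | rayDist x.1 y.1 < s} = ENNReal.ofReal (s ^ (2 * n)) := by
    intro s hs hs1 x
    rw [← gaussian_rayDist_lt x.2 hs hs1]
    exact gaussianNeZero_apply {y | rayDist x.1 y < s}
  have hD : Measurable fun p : {v : EuclideanSpace ℂ (Fin (n + 1)) // v ≠ 0} ×
      {v : EuclideanSpace ℂ (Fin (n + 1)) // v ≠ 0} ↦ rayDist p.1.1 p.2.1 := by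
    unfold rayDist
    fun_prop
  -- The space is that of nonzero vectors because `rayDist 0 0 = 1`, against the requirement `D x x
  -- = 0`.
  obtain ⟨C, hcard, hC⟩ := exists_covering (μ := gaussianNeZero (n + 1))
    (D := fun x y ↦ rayDist x.1 y.1) hD
    (fun x ↦ rayDist_self x.2) (fun x y ↦ rayDist_comm _ _)
    (fun x y z ↦ rayDist_triangle x.2 y.2 z.2) (by positivity) (hball r hr0 hr)
    (pow_le_one₀ hr0.le hr) (by positivity) (hball δ hδ (hδr.trans hr)) hδ hδr M
  exact ⟨C.card, mem_encodingSizes_of_rayDist_lt hε (by linarith) C hC, hcard⟩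

lemma exists_mem_encodingSizes_le_log {n : ℕ} {r δ ε : ℝ} (hδ : 0 < δ) (hδr : δ ≤ r)
    (hr : r ≤ 1) (hε : r + δ < ε) :
    ∃ N ∈ encodingSizes (n + 1) ε,
      (N : ℝ) ≤ (2 * n * Real.log (r / δ) + 1) / r ^ (2 * n) + 1 := by
  have hr0 : 0 < r := hδ.trans_le hδr
  set V := r ^ (2 * n) with hV
  have hV0 : 0 < V := by positivity
  have hV1 : V ≤ 1 := pow_le_one₀ hr0.le hr
  -- Chosen so that `exp (-a) = (δ / r) ^ (2 * n)`: after `⌈a / V⌉₊` greedy balls the packing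
  -- contributes at most `1 / V` points.
  set a := 2 * n * Real.log (r / δ) with ha
  have ha0 : 0 ≤ a := by
    have : 0 ≤ Real.log (r / δ) := Real.log_nonneg ((one_le_div hδ).2 hδr)
    positivity
  obtain ⟨N, hN, hle⟩ := exists_mem_encodingSizes_le (n := n) hδ hδr hr hε ⌈a / V⌉₊
  refine ⟨N, hN, hle.trans ?_⟩
  have h1 : ((⌈a / V⌉₊ : ℕ) : ℝ) ≤ a / V + 1 := (Nat.ceil_lt_add_one (by positivity)).le
  have h2 : (1 - V) ^ ⌈a / V⌉₊ ≤ (δ / r) ^ (2 * n) := by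
    calc (1 - V) ^ ⌈a / V⌉₊ ≤ Real.exp (-V) ^ ⌈a / V⌉₊ := by
          gcongr
          linarith [Real.add_one_le_exp (-V)]
      _ = Real.exp (-(⌈a / V⌉₊ * V)) := by rw [← Real.exp_nat_mul]; ring_nf
      _ ≤ Real.exp (-a) := by
          gcongr
          rw [← div_le_iff₀ hV0]
          exact Nat.le_ceil _
      _ = (δ / r) ^ (2 * n) := by
          rw [ha, ← mul_neg, ← Real.log_inv, inv_div, ← Real.exp_log (by positivity : 0 < δ / r),
            ← Real.exp_nat_mul, Real.log_exp]
          push_cast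
          rfl
  have h3 : (1 - V) ^ ⌈a / V⌉₊ / δ ^ (2 * n) ≤ 1 / V := by
    rw [div_le_iff₀ (by positivity)]
    refine h2.trans (le_of_eq ?_)
    rw [div_pow, hV]
    ring
  rw [add_div]
  linarith

/-! ### Numerical inequality behind `5 d ln d` -/

section Numerics

open Real

lemma log_le_mul_log_two {x : ℝ} (hx : 0 < x) {k m : ℕ} (hk : 0 < k) (h : x ^ k ≤ 2 ^ m) :
    log x ≤ m / k * log 2 := by
  have := log_le_log (by positivity) h
  rw [log_pow, log_pow] at this
  have hk' : (0 : ℝ) < k := by exact_mod_cast hk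
  rw [div_mul_eq_mul_div, le_div_iff₀ hk']
  linarith

lemma mul_log_two_le_log {x : ℝ} {k m : ℕ} (hk : 0 < k) (h : 2 ^ m ≤ x ^ k) :
    m / k * log 2 ≤ log x := by
  have := log_le_log (by positivity) h
  rw [log_pow, log_pow] at this
  have hk' : (0 : ℝ) < k := by exact_mod_cast hk
  rw [div_mul_eq_mul_div, div_le_iff₀ hk']
  linarith

lemma covering_numerics_of_le {n : ℕ} (hn : 6 ≤ n) :
    (6 * n / (6 * n - 1) : ℝ) ^ (2 * n) * (2 * n * log (7 * n - 7 / 6) + 1) + (1 / 4) ^ n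
      ≤ 5 * (n + 1) * log (n + 1) := by
  have hn' : (6 : ℝ) ≤ n := by exact_mod_cast hn
  have hX : (6 * n / (6 * n - 1) : ℝ) ^ (2 * n) ≤ 1.41 := by
    have h1 : (6 * n / (6 * n - 1) : ℝ) ≤ exp (1 / (6 * n - 1)) := by
      have := add_one_le_exp (1 / (6 * n - 1) : ℝ)
      refine le_trans (le_of_eq ?_) this
      have : (6 * n - 1 : ℝ) ≠ 0 := by linarith
      field_simp
      ring
    -- `12 / 35` is the value at `n = 6` of the decreasing `2 n / (6 n - 1)`.
    have h2 : exp (12 / 35) ≤ 1.41 := by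
      have h3 : exp (12 / 35) ^ 35 ≤ 1.41 ^ 35 := by
        rw [← exp_nat_mul]
        have : ((35 : ℕ) : ℝ) * (12 / 35) = ((12 : ℕ) : ℝ) * 1 := by norm_num
        rw [this, exp_nat_mul]
        calc exp 1 ^ 12 ≤ 2.7182818286 ^ 12 := by
              gcongr
              exact exp_one_lt_d9.le
          _ ≤ _ := by norm_num
      exact le_of_pow_le_pow_left₀ (by norm_num) (by norm_num) h3
    calc (6 * n / (6 * n - 1) : ℝ) ^ (2 * n) ≤ exp (1 / (6 * n - 1)) ^ (2 * n) := by
          gcongr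
          exact div_nonneg (by linarith) (by linarith)
      _ = exp (2 * n / (6 * n - 1)) := by
          rw [← exp_nat_mul]
          push_cast
          ring_nf
      _ ≤ exp (12 / 35) := by
          refine exp_le_exp.2 ?_
          rw [div_le_div_iff₀ (by linarith) (by norm_num)]
          linarith
      _ ≤ 1.41 := h2
  have hl2 := log_two_gt_d9
  have hl2' := log_two_lt_d9
  have hlog7 : log 7 ≤ 1.964 := by
    have := log_le_mul_log_two (x := 7) (k := 6) (m := 17) (by norm_num) (by norm_num) (by norm_num)
    norm_num at this ⊢
    linarith
  set L := log ((n : ℝ) + 1) with hL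
  have hlog : log (7 * n - 7 / 6) ≤ L + 1.964 := by
    calc log (7 * n - 7 / 6) ≤ log (7 * (n + 1)) := log_le_log (by linarith) (by linarith)
      _ = log 7 + L := log_mul (by norm_num) (by linarith)
      _ ≤ _ := by linarith
  have hlog0 : 0 ≤ log (7 * n - 7 / 6 : ℝ) := log_nonneg (by linarith)
  have hpow : (1 / 4 : ℝ) ^ n ≤ 1 / 4000 := by
    calc (1 / 4 : ℝ) ^ n ≤ (1 / 4) ^ 6 := pow_le_pow_of_le_one (by norm_num) (by norm_num) hn
      _ ≤ _ := by norm_num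
  have hmul : (6 * n / (6 * n - 1) : ℝ) ^ (2 * n) * (2 * n * log (7 * n - 7 / 6) + 1)
      ≤ 1.41 * (2 * n * (L + 1.964) + 1) := by
    gcongr
  have hmono : ∀ m : ℝ, 0 < m → m ≤ n + 1 → log m ≤ L := fun m hm h ↦ log_le_log hm h
  -- As `5 (n + 1) > 2.82 n`, it suffices to have the inequality at a lower bound `ℓ` of `L`. It is
  -- then affine in `n`, and the ranges below are those on which one numerical `ℓ` works.
  have key : ∀ ℓ : ℝ, ℓ ≤ L → 1.41 * (2 * n * (ℓ + 1.964) + 1) + 1 / 4000 ≤ 5 * (n + 1) * ℓ →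
      1.41 * (2 * n * (L + 1.964) + 1) + 1 / 4000 ≤ 5 * (n + 1) * L := by
    intro ℓ h h'
    nlinarith
  refine (add_le_add hmul hpow).trans ?_
  rcases hn.eq_or_lt with h | h
  · have h7 := mul_log_two_le_log (x := 7) (k := 5) (m := 14) (by norm_num) (by norm_num)
    have := hmono 7 (by norm_num) (by linarith)
    norm_num at h7
    refine key 1.94 (by linarith) ?_
    rw [← h]
    norm_num
  have h7' : (7 : ℝ) ≤ n := by exact_mod_cast h
  by_cases h8 : n ≤ 8
  · have h8' : (n : ℝ) ≤ 8 := by exact_mod_cast h8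
    have h7 := mul_log_two_le_log (x := 8) (k := 1) (m := 3) (by norm_num) (by norm_num)
    have := hmono 8 (by norm_num) (by linarith)
    norm_num at h7
    refine key 2.079 (by linarith) ?_
    linarith
  have h9' : (9 : ℝ) ≤ n := by exact_mod_cast not_le.1 h8
  by_cases h15 : n ≤ 15
  · have h15' : (n : ℝ) ≤ 15 := by exact_mod_cast h15
    have h7 := mul_log_two_le_log (x := 10) (k := 10) (m := 33) (by norm_num) (by norm_num)
    have := hmono 10 (by norm_num) (by linarith)
    norm_num at h7
    refine key 2.28 (by linarith) ?_
    linarith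
  have h16' : (16 : ℝ) ≤ n := by exact_mod_cast not_le.1 h15
  have h7 := mul_log_two_le_log (x := 16) (k := 1) (m := 4) (by norm_num) (by norm_num)
  have := hmono 16 (by norm_num) (by linarith)
  norm_num at h7
  refine key 2.77 (by linarith) ?_
  linarith

lemma covering_numerics {n : ℕ} (hn : 1 ≤ n) :
    (6 * n / (6 * n - 1) : ℝ) ^ (2 * n) * (2 * n * log (7 * n - 7 / 6) + 1) + (1 / 4) ^ n
      ≤ 5 * (n + 1) * log (n + 1) := by
  rcases le_or_gt 6 n with h6 | h6
  · exact covering_numerics_of_le h6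
  have hl2 := log_two_gt_d9
  have hl2' := log_two_lt_d9
  interval_cases n
  · have h1 := log_le_mul_log_two (x := 35 / 6) (k := 11) (m := 28) (by norm_num) (by norm_num)
      (by norm_num)
    norm_num at h1 ⊢
    linarith
  · have h1 := log_le_mul_log_two (x := 77 / 6) (k := 10) (m := 37) (by norm_num) (by norm_num)
      (by norm_num)
    have h2 := mul_log_two_le_log (x := 3) (k := 12) (m := 19) (by norm_num) (by norm_num)
    norm_num at h1 h2 ⊢
    linarith
  · have h1 := log_le_mul_log_two (x := 119 / 6) (k := 3) (m := 13) (by norm_num) (by norm_num)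
      (by norm_num)
    have h2 := mul_log_two_le_log (x := 4) (k := 1) (m := 2) (by norm_num) (by norm_num)
    norm_num at h1 h2 ⊢
    linarith
  · have h1 := log_le_mul_log_two (x := 161 / 6) (k := 4) (m := 19) (by norm_num) (by norm_num)
      (by norm_num)
    have h2 := mul_log_two_le_log (x := 5) (k := 7) (m := 16) (by norm_num) (by norm_num)
    norm_num at h1 h2 ⊢
    linarith
  · have h1 := log_le_mul_log_two (x := 203 / 6) (k := 5) (m := 26) (by norm_num) (by norm_num)
      (by norm_num)
    have h2 := mul_log_two_le_log (x := 6) (k := 7) (m := 18) (by norm_num) (by norm_num)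
    norm_num at h1 h2 ⊢
    linarith

end Numerics

lemma exists_mem_encodingSizes_le_five_mul {n : ℕ} (hn : 1 ≤ n) {ε : ℝ} (hε₀ : 0 < ε)
    (hε : ε ≤ 1 / 2) :
    ∃ N ∈ encodingSizes (n + 1) ε,
      (N : ℝ) ≤ (1 / ε) ^ (2 * n) * (5 * (n + 1) * Real.log (n + 1)) := by
  have hn' : (1 : ℝ) ≤ n := by exact_mod_cast hn
  -- Giving up a fraction `1 / (6 n)` of `ε` costs only a bounded factor in `r ^ (2 * n)` and leaves
  -- room for `δ`, since `1 / (7 n) < 1 / (6 n)`.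
  set r : ℝ := (6 * n - 1) / (6 * n) * ε with hr
  set δ : ℝ := ε / (7 * n) with hδ
  have h6 : (0 : ℝ) < 6 * n - 1 := by linarith
  have hδ0 : 0 < δ := by positivity
  have hr0 : 0 < r := by positivity
  have hratio : r / δ = 7 * n - 7 / 6 := by
    rw [hr, hδ]
    field_simp
  have hδr : δ ≤ r := by
    rw [← one_le_div hδ0, hratio]
    linarith
  have hrε : r + δ < ε := by
    have : r + δ = ε * (1 - 1 / (42 * n)) := by
      rw [hr, hδ]
      field_simp
      ring
    rw [this]
    have : 0 < 1 / (42 * (n : ℝ)) := by positivity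
    nlinarith
  obtain ⟨N, hN, hle⟩ := exists_mem_encodingSizes_le_log (n := n) hδ0 hδr (by linarith) hrε
  refine ⟨N, hN, hle.trans ?_⟩
  have hnum := covering_numerics hn
  have hεpow : ε ^ (2 * n) ≤ (1 / 4) ^ n := by
    rw [pow_mul]
    have : ε ^ 2 ≤ 1 / 4 := by nlinarith
    gcongr
  have hrpow : 1 / r ^ (2 * n) = (1 / ε) ^ (2 * n) * (6 * n / (6 * n - 1) : ℝ) ^ (2 * n) := by
    rw [← one_div_pow, ← mul_pow, hr]
    congr 1
    field_simp
  -- The additive `1` from rounding up becomes `ε ^ (2 * n) ≤ (1 / 4) ^ n` once the volume factor is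
  -- taken out.
  have hone : (1 : ℝ) = (1 / ε) ^ (2 * n) * ε ^ (2 * n) := by
    rw [← mul_pow, one_div_mul_cancel hε₀.ne', one_pow]
  rw [div_eq_mul_one_div, hrpow, hratio]
  calc _ = (1 / ε) ^ (2 * n) * ((6 * n / (6 * n - 1) : ℝ) ^ (2 * n)
          * (2 * n * Real.log (7 * n - 7 / 6) + 1) + ε ^ (2 * n)) := by
        rw [mul_add, ← hone]
        ring
    _ ≤ _ := by
        gcongr
        linarith

lemma two_mul_rate_le_logb {n N : ℕ} {ε : ℝ} (hε : 0 < ε) (h : 1 ≤ N * ε ^ (2 * n)) :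
    2 * rate (n + 1) ε ≤ Real.logb 2 N := by
  have hpow : (1 / ε) ^ (2 * n) ≤ N := by
    rw [one_div_pow, div_le_iff₀ (by positivity)]
    exact h
  have := Real.logb_le_logb_of_le (b := 2) (by norm_num) (by positivity) hpow
  rw [Real.logb_pow] at this
  refine le_trans (le_of_eq ?_) this
  rw [rate]
  push_cast
  ring

end Bounds

end StateEncoding

end

/-- The minimum size `N` of the label set of a deterministic encoding exists and is bounded from
below and above. -/
theorem theorem1 (d : ℕ) (hd : 2 ≤ d) (ε : ℝ) (hε₀ : 0 < ε) (hε₁ : ε ≤ 1 / 2) :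
    ∃ N : ℕ, IsLeast (StateEncoding.encodingSizes d ε) N ∧
      2 * StateEncoding.rate d (2 * ε) ≤ Real.logb 2 (N : ℝ) ∧
      Real.logb 2 (N : ℝ) ≤
        2 * StateEncoding.rate d ε + Real.logb 2 (5 * (d : ℝ) * Real.log (d : ℝ)) ∧
      (4 ≤ d → 2 * StateEncoding.rate d ε ≤ Real.logb 2 (N : ℝ)) := by
  open StateEncoding in
  obtain ⟨n, rfl⟩ : ∃ n, d = n + 1 := ⟨d - 1, by omega⟩
  have hn : 1 ≤ n := by omega
  obtain ⟨N', hN', hle⟩ := exists_mem_encodingSizes_le_five_mul hn hε₀ hε₁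
  have hmem : sInf (encodingSizes (n + 1) ε) ∈ encodingSizes (n + 1) ε := Nat.sInf_mem ⟨N', hN'⟩
  refine ⟨sInf (encodingSizes (n + 1) ε), ⟨hmem, fun k hk ↦ Nat.sInf_le hk⟩, ?_, ?_, fun h4 ↦ ?_⟩
  · exact two_mul_rate_le_logb (by linarith) (one_le_mul_of_mem_encodingSizes hε₀ hε₁ hmem
      fun q x hx hsum hq ↦ prod_capFactor_le_two_mul x hx hsum hq hε₁)
  · have h1 := one_le_mul_of_mem_encodingSizes hε₀ hε₁ hmem
      fun q x hx hsum hq ↦ prod_capFactor_le_two_mul x hx hsum hq hε₁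
    set N := sInf (encodingSizes (n + 1) ε) with hNdef
    -- Monotonicity of the logarithm needs `N ≠ 0`, which the lower bound supplies.
    have hN0 : (0 : ℝ) < N := by
      by_contra! h
      have : 0 < (2 * ε) ^ (2 * n) := by positivity
      nlinarith
    have hNle : (N : ℝ) ≤ (1 / ε) ^ (2 * n) * (5 * (n + 1) * Real.log (n + 1)) :=
      le_trans (by exact_mod_cast Nat.sInf_le hN') hle
    have hlog : 0 < Real.log ((n : ℝ) + 1) := Real.log_pos (by
      have : (1 : ℝ) ≤ n := by exact_mod_cast hn
      linarith)
    have := Real.logb_le_logb_of_le (b := 2) (by norm_num) hN0 hNle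
    rw [Real.logb_mul (by positivity) (by positivity), Real.logb_pow] at this
    refine this.trans (le_of_eq ?_)
    rw [rate]
    push_cast
    ring
  · exact two_mul_rate_le_logb hε₀ (one_le_mul_of_mem_encodingSizes hε₀ hε₁ hmem
      fun q x hx hsum hq ↦ prod_capFactor_le (by omega) x hx hsum hq hε₁)
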